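/- Let $A$ be a unital separable C*-algebra and let $\varphi_n : A \to M_{k_n}(\mathbb{C})$ ($n\in\mathbb{N}$) be a sequence of unital completely positive maps, with multiplicative domains $$A_{\varphi_n}=\{a\in A : \varphi_n(a^*a)=\varphi_n(a)^*\varphi_n(a)\ \text{and}\ \varphi_n(aa^*)=\varphi_n(a)\varphi_n(a)^*\},$$ such that for every $a\in A$ $$\lim_{n\to\infty}\|\varphi_n(a)\| = \|a\| \quad\text{and}\quad \lim_{n\to\infty}\operatorname{dist}(a, A_{\varphi_n}) = 0 .$$ Let $\alpha$ be an action of a finite group $G$ on $A$ by $*$-automorphisms such that $\alpha_g(A_{\varphi_n}) = A_{\varphi_n}$ for all $n\in\mathbb{N}$ and $g\in G$. Let $A\rtimes_\alpha G$ be the crossed product, i.e. the C*-subalgebra of $A\otimes B(\ell^2(G))\cong M_{|G|}(A)$ generated by the elements $\sum_{g\in G}\alpha_g^{-1}(a)\otimes e_{g,g}$ ($a\in A$) and $1\otimes\lambda_h$ ($h\in G$), where the $e_{s,t}$ are the canonical matrix units of $B(\ell^2(G))$ and $\lambda$ is the left regular representation of $G$. Then $A\rtimes_\alpha G$ is inner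 quasidiagonal: for all $x_1,\dots,x_m\in A\rtimes_\alpha G$ and $\varepsilon>0$ there are a representation $\pi$ of $A\rtimes_\alpha G$ on a Hilbert space and a finite-rank projection $P\in\pi(A\rtimes_\alpha G)''$ such that $\|P\pi(x_i)-\pi(x_i)P\|<\varepsilon$ and $\|P\pi(x_i)P\|>\|x_i\|-\varepsilon$ for $1\le i\le m$. -/

import Mathlib

open Filter Topology
open scoped ComplexOrder CStarAlgebra

noncomputable section

universe u v

/-- A C⋆-algebra `A` is inner quasidiagonal if for all `x₁, …, xₙ ∈ A` and `ε > 0` there are a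
representation `π` of `A` on a Hilbert space `H` and a finite-rank projection `P` in the double
commutant `π(A)''` such that `‖P π(xᵢ) - π(xᵢ) P‖ < ε` and `‖P π(xᵢ) P‖ > ‖xᵢ‖ - ε` for all `i`.
(Taking `H` in the universe of `A` loses nothing: one may always cut down to the closed
`π(A)`-invariant subspace generated by the range of `P`.) -/
def InnerQuasidiagonal (A : Type u) [NonUnitalCStarAlgebra A] : Prop :=
  ∀ (n : ℕ) (x : Fin n → A) (ε : ℝ), 0 < ε →
    ∃ (H : Type u) (_ : NormedAddCommGroup H) (_ : InnerProductSpace ℂ H) (_ : CompleteSpace H)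
      (π : A →⋆ₙₐ[ℂ] (H →L[ℂ] H)) (P : H →L[ℂ] H),
      IsStarProjection P ∧
      FiniteDimensional ℂ P.range ∧
      P ∈ Set.centralizer (Set.centralizer (Set.range π)) ∧
      ∀ i, ‖P * π (x i) - π (x i) * P‖ < ε ∧ ‖x i‖ - ε < ‖P * π (x i) * P‖

/-- The multiplicative domain of a map `φ : A → B` (used for unital completely positive `φ`). -/
def multiplicativeDomain {A : Type u} {B : Type v} [Mul A] [Star A] [Mul B] [Star B]
    (φ : A → B) : Set A :=
  {a | φ (star a * a) = star (φ a) * φ a ∧ φ (a * star a) = φ a * star (φ a)}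

/-- The C⋆-algebra `M_k(ℂ)` of complex `k × k` matrices, with the operator norm. -/
abbrev MatrixAlgebra (k : ℕ) : Type := CStarMatrix (Fin k) (Fin k) ℂ

section CrossedProduct

variable {A : Type u} [CStarAlgebra A] [PartialOrder A] [StarOrderedRing A]
variable {G : Type v} [Group G] [Fintype G] [DecidableEq G]

/-- The element `∑_g α_g⁻¹(a) ⊗ e_{g,g}` of `A ⊗ B(ℓ²(G)) = M_G(A)`. -/
def covariantCoeff (α : G →* (A ≃⋆ₐ[ℂ] A)) (a : A) : CStarMatrix G G A :=
  CStarMatrix.ofMatrix (Matrix.diagonal fun g => (α g)⁻¹ a)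

variable (A) in
/-- The element `1 ⊗ λ_h` of `A ⊗ B(ℓ²(G)) = M_G(A)`, where `λ_h δ_t = δ_{ht}`. -/
def covariantUnitary (h : G) : CStarMatrix G G A :=
  CStarMatrix.ofMatrix (Matrix.of fun s t => if s = h * t then 1 else 0)

/-- The crossed product `A ⋊_α G` by an action of a finite group: the C⋆-subalgebra of
`A ⊗ B(ℓ²(G)) = M_G(A)` generated by the elements `∑_g α_g⁻¹(a) ⊗ e_{g,g}` for `a ∈ A` and
`1 ⊗ λ_h` for `h ∈ G`. -/
def CrossedProduct (α : G →* (A ≃⋆ₐ[ℂ] A)) : StarSubalgebra ℂ (CStarMatrix G G A) :=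
  (StarAlgebra.adjoin ℂ
    (Set.range (covariantCoeff α) ∪ Set.range (covariantUnitary A (G := G)))).topologicalClosure

instance CrossedProduct.instCStarAlgebra (α : G →* (A ≃⋆ₐ[ℂ] A)) :
    CStarAlgebra (CrossedProduct α) :=
  StarSubalgebra.cstarAlgebra (CrossedProduct α)
    (h_closed := StarSubalgebra.isClosed_topologicalClosure _)

end CrossedProduct

end

-- The entrywise amplifications of the `φ n` to `M_G(A)`, restricted to the crossed product,
-- approximate it well enough to produce inner projections.
--
-- Approximation. Matrices with entries in the multiplicative domain of `φ n` are multiplied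
-- correctly by the amplification. As the domains are asymptotically dense, the amplifications are
-- asymptotically multiplicative, so morally they define a star-homomorphism into a sequence algebra
-- modulo null sequences. It is injective because it is so entrywise, hence isometric;
-- `eventually_lt_norm_of_asymptotically_multiplicative` gives the lower norm bound directly.
-- Invariance of the domains under `α` keeps the approximants inside the crossed product
-- (`CrossedProduct.eventually_exists_entriesIn`).
--
-- Criterion. `innerQuasidiagonal_of_positive_maps` needs only a unital positive `Ψ` into operators
-- on a finite-dimensional space, almost isometric on the given elements and multiplicative on a
-- star-subalgebra `D` nearly containing them. A vector state of `Ψ` nearly attaining `‖Ψ d‖` kills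
-- `e⋆ e` for every `e ∈ D ∩ ker Ψ`. An extreme point argument replaces it by a pure state with both
-- properties. In its irreducible GNS representation the `D`-orbit of the cyclic vector is a linear
-- image of `D / (D ∩ ker Ψ)`, so it is finite-dimensional. A finite sum of irreducibles has
-- finite-dimensional commutant; saturating the orbits under it gives a finite-dimensional space
-- whose projection lies in the double commutant, commutes with `D`, and preserves the norms seen by
-- the pure states.

universe u v

/-! ### Compactness of state spaces and existence of pure states. -/

section States

variable {B : Type*} [CStarAlgebra B] [PartialOrder B] [StarOrderedRing B]

/-- A positive functional `f` is pure if every positive functional dominated by `f` is a scalar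
multiple of `f`. -/
def IsPureFunctional (f : B →ₚ[ℂ] ℂ) : Prop :=
  ∀ g : B →ₚ[ℂ] ℂ, (∀ b, 0 ≤ b → g b ≤ f b) → ∃ c : ℂ, ∀ b, g b = c * f b

/-- The positive functional given by a linear map that is nonnegative on elements `b⋆ b`. -/
noncomputable def PositiveLinearMap.ofStarMulSelf (f : B →ₗ[ℂ] ℂ) (hf : ∀ b, 0 ≤ f (star b * b)) :
    B →ₚ[ℂ] ℂ :=
  .mk₀ f fun a ha => by
    obtain ⟨b, rfl⟩ := CStarAlgebra.nonneg_iff_eq_star_mul_self.mp ha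
    exact hf b

@[simp]
lemma PositiveLinearMap.ofStarMulSelf_apply (f : B →ₗ[ℂ] ℂ) (hf : ∀ b, 0 ≤ f (star b * b))
    (b : B) : PositiveLinearMap.ofStarMulSelf f hf b = f b := rfl

/-- Splitting `b` into four positive parts costs a factor 4, harmless since only continuity with a
uniform constant is needed. -/
lemma PositiveLinearMap.norm_apply_le_four_mul {F : Type*} [CStarAlgebra F] [PartialOrder F]
    [StarOrderedRing F] (f : B →ₚ[ℂ] F) (b : B) : ‖f b‖ ≤ 4 * ‖f 1‖ * ‖b‖ := by
  obtain ⟨y, hy_nonneg, hy_norm, hy⟩ := CStarAlgebra.exists_sum_four_nonneg b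
  conv_lhs => rw [hy]
  simp only [map_sum, map_smul]
  refine (norm_sum_le _ _).trans ?_
  simp only [norm_smul, norm_pow, Complex.norm_I, one_pow, one_mul]
  refine (Finset.sum_le_sum (g := fun _ => ‖f 1‖ * ‖b‖) fun i _ => ?_).trans
    (by simp [mul_assoc])
  refine (f.norm_apply_le_of_nonneg _ (hy_nonneg i)).trans ?_
  gcongr
  exact hy_norm i

/-- The states of `B` vanishing on `Z`, as a subset of the function space `B → ℂ`. -/
def statesVanishingOn (Z : Set B) : Set (B → ℂ) :=
  {F | ∃ f : B →ₚ[ℂ] ℂ, ⇑f = F ∧ f 1 = 1 ∧ ∀ z ∈ Z, f z = 0}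

lemma statesVanishingOn_eq (Z : Set B) : statesVanishingOn Z =
    {F | (∀ a b, F (a + b) = F a + F b) ∧ (∀ (c : ℂ) b, F (c • b) = c * F b) ∧
      (∀ b, 0 ≤ F (star b * b)) ∧ F 1 = 1 ∧ ∀ z ∈ Z, F z = 0} := by
  ext F
  constructor
  · rintro ⟨f, rfl, h1, hZ⟩
    exact ⟨map_add f, fun c b => by simp, fun b => f.map_nonneg (star_mul_self_nonneg b), h1, hZ⟩
  · rintro ⟨hadd, hsmul, hpos, h1, hZ⟩
    exact ⟨.ofStarMulSelf ⟨⟨F, hadd⟩, hsmul⟩ hpos, rfl, h1, hZ⟩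

/-- Banach–Alaoglu: the defining conditions are pointwise closed, and Tychonoff applies to the
product of discs. -/
lemma isCompact_statesVanishingOn (Z : Set B) : IsCompact (statesVanishingOn Z) := by
  have hK : IsCompact (Set.univ.pi fun b : B => Metric.closedBall (0 : ℂ) (4 * ‖b‖)) :=
    isCompact_univ_pi fun b => isCompact_closedBall _ _
  refine hK.of_isClosed_subset ?_ ?_
  · rw [statesVanishingOn_eq]
    simp only [Set.ofPred_and, Set.ofPred_forall]
    refine IsClosed.inter ?_ (IsClosed.inter ?_ (IsClosed.inter ?_ (IsClosed.inter ?_ ?_)))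
    · exact isClosed_iInter fun a => isClosed_iInter fun b =>
        isClosed_eq (by fun_prop) (by fun_prop)
    · exact isClosed_iInter fun a => isClosed_iInter fun b =>
        isClosed_eq (by fun_prop) (by fun_prop)
    · exact isClosed_iInter fun b => isClosed_le continuous_const (by fun_prop)
    · exact isClosed_eq (by fun_prop) continuous_const
    · exact isClosed_iInter fun z => isClosed_iInter fun _ =>
        isClosed_eq (by fun_prop) continuous_const
  · rintro F ⟨f, rfl, h1, -⟩ b -
    simpa [h1] using f.norm_apply_le_four_mul b

/-- Among the states vanishing on a set `Z` of positive elements there is a pure one whose value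
at `b₀` has real part at least that of a given such state. -/
theorem exists_isPureFunctional (Z : Set B) (hZ : ∀ z ∈ Z, 0 ≤ z) (b₀ : B) (f₀ : B →ₚ[ℂ] ℂ)
    (hf₀ : f₀ 1 = 1) (hf₀Z : ∀ z ∈ Z, f₀ z = 0) :
    ∃ f : B →ₚ[ℂ] ℂ, IsPureFunctional f ∧ f 1 = 1 ∧ (∀ z ∈ Z, f z = 0) ∧
      (f₀ b₀).re ≤ (f b₀).re := by
  set S := statesVanishingOn Z with hS
  have hScomp : IsCompact S := isCompact_statesVanishingOn Z
  have hev : Continuous fun F : B → ℂ => (F b₀).re := by fun_prop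
  obtain ⟨F₁, hF₁S, hF₁⟩ := hScomp.exists_isMaxOn ⟨f₀, f₀, rfl, hf₀, hf₀Z⟩ hev.continuousOn
  -- The maximisers form a compact face of `S`, so an extreme point of `S'` cannot be split inside
  -- `S` either.
  set S' := S ∩ {F | (F b₀).re = (F₁ b₀).re}
  have hS'comp : IsCompact S' := hScomp.inter_right (isClosed_eq hev continuous_const)
  obtain ⟨F, ⟨⟨f, rfl, hf1, hfZ⟩, hfb⟩, hext⟩ := hS'comp.extremePoints_nonempty ⟨F₁, hF₁S, rfl⟩
  refine ⟨f, fun g hg => ?_, hf1, hfZ, ?_⟩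
  swap
  · rw [show (f b₀).re = (F₁ b₀).re from hfb]
    exact hF₁ ⟨f₀, rfl, hf₀, hf₀Z⟩
  have hg1 := hg 1 zero_le_one
  have hg0 : 0 ≤ g 1 := g.map_nonneg zero_le_one
  obtain ⟨s, hs⟩ : ∃ s : ℝ, g 1 = s := ⟨(g 1).re, (Complex.eq_re_of_ofReal_le hg0)⟩
  rw [hf1, hs] at hg1
  rw [hs] at hg0
  have hs0 : 0 ≤ s := by exact_mod_cast hg0
  have hs1 : s ≤ 1 := by exact_mod_cast hg1
  -- the two states of which `f` is a convex combination
  have key : ∀ (h : B →ₗ[ℂ] ℂ) (t : ℝ), 0 < t → (∀ b, 0 ≤ b → 0 ≤ h b) → h 1 = t →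
      (∀ z ∈ Z, h z = 0) → (fun b => (t : ℂ)⁻¹ * h b) ∈ S := by
    intro h t ht hpos h1 hz
    refine ⟨.ofStarMulSelf ((t : ℂ)⁻¹ • h) fun b => ?_, ?_, ?_, ?_⟩
    · simp only [LinearMap.smul_apply, smul_eq_mul]
      exact mul_nonneg (by simpa using ht.le) (hpos _ (star_mul_self_nonneg b))
    · ext b; simp
    · simp [h1, ht.ne']
    · intro z hz'; simp [hz z hz']
  have hgZ : ∀ z ∈ Z, g z = 0 := fun z hz =>
    le_antisymm ((hg z (hZ z hz)).trans (hfZ z hz).le) (g.map_nonneg (hZ z hz))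
  -- The splitting `f = g + (f - g)` would require dividing by `s` and `1 - s`, which may vanish.
  -- The masses `1 + s` and `2 - s` are at least 1, and `f` is still one third of the sum of these
  -- two functionals.
  have m₁ := key (f.toLinearMap + g.toLinearMap) (1 + s) (by linarith)
    (fun b hb => by simpa using add_nonneg (f.map_nonneg hb) (g.map_nonneg hb))
    (by simp [hf1, hs]) (fun z hz => by simp [hfZ z hz, hgZ z hz])
  have m₂ := key ((2 : ℂ) • f.toLinearMap - g.toLinearMap) (2 - s) (by linarith)
    (fun b hb => by
      have := add_nonneg (f.map_nonneg hb) (sub_nonneg.mpr (hg b hb))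
      simp only [LinearMap.sub_apply, LinearMap.smul_apply, smul_eq_mul,
        PositiveLinearMap.coe_toLinearMap]
      convert this using 1; ring)
    (by simp [hf1, hs]) (fun z hz => by simp [hfZ z hz, hgZ z hz])
  set G₁ : B → ℂ := fun b => ((1 + s : ℝ) : ℂ)⁻¹ * (f.toLinearMap + g.toLinearMap) b with hG₁
  set G₂ : B → ℂ := fun b => ((2 - s : ℝ) : ℂ)⁻¹ * ((2 : ℂ) • f.toLinearMap - g.toLinearMap) b
    with hG₂
  have hcomb : ((1 + s) / 3) • G₁ + ((2 - s) / 3) • G₂ = ⇑f := by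
    ext b
    have h1 : (1 + s : ℂ) ≠ 0 := by exact_mod_cast (by linarith : (1 + s : ℝ) ≠ 0)
    have h2 : (2 - s : ℂ) ≠ 0 := by exact_mod_cast (by linarith : (2 - s : ℝ) ≠ 0)
    simp only [hG₁, hG₂, Pi.add_apply, Pi.smul_apply, LinearMap.add_apply, LinearMap.sub_apply,
      LinearMap.smul_apply, Complex.real_smul, PositiveLinearMap.coe_toLinearMap,
      smul_eq_mul]
    push_cast
    field_simp
    ring
  have l₁ : (G₁ b₀).re ≤ (F₁ b₀).re := hF₁ m₁
  have l₂ : (G₂ b₀).re ≤ (F₁ b₀).re := hF₁ m₂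
  have hsum : (1 + s) / 3 * (G₁ b₀).re + (2 - s) / 3 * (G₂ b₀).re = (F₁ b₀).re := by
    rw [← show (f b₀).re = (F₁ b₀).re from hfb, ← hcomb]
    simp
  have e₁ : (G₁ b₀).re = (F₁ b₀).re := by nlinarith
  have e₂ : (G₂ b₀).re = (F₁ b₀).re := by nlinarith
  have heq : G₁ = ⇑f := hext ⟨m₁, e₁⟩ ⟨m₂, e₂⟩
    ⟨(1 + s) / 3, (2 - s) / 3, by linarith, by linarith, by ring, hcomb⟩
  refine ⟨s, fun b => ?_⟩
  have hb := congrFun heq b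
  have h1 : (1 + s : ℂ) ≠ 0 := by exact_mod_cast (by linarith : (1 + s : ℝ) ≠ 0)
  simp only [hG₁, LinearMap.add_apply, PositiveLinearMap.coe_toLinearMap] at hb
  push_cast at hb
  rw [inv_mul_eq_iff_eq_mul₀ h1] at hb
  linear_combination hb

end States

/-! ### Purity implies irreducibility. -/

section Irreducible

open scoped InnerProductSpace

variable {B : Type*} [CStarAlgebra B]

/-- A representation is irreducible if its commutant is trivial. -/
def IsIrreducibleRep {H : Type*} [NormedAddCommGroup H] [InnerProductSpace ℂ H] [CompleteSpace H]
    (π : B →⋆ₐ[ℂ] (H →L[ℂ] H)) : Prop :=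
  ∀ T : H →L[ℂ] H, (∀ b, T * π b = π b * T) → ∃ c : ℂ, T = c • (1 : H →L[ℂ] H)

variable {H : Type*} [NormedAddCommGroup H] [InnerProductSpace ℂ H] [CompleteSpace H]

lemma StarAlgHom.inner_apply_left (π : B →⋆ₐ[ℂ] (H →L[ℂ] H)) (b : B) (x y : H) :
    ⟪π b x, y⟫_ℂ = ⟪x, π (star b) y⟫_ℂ := by
  rw [map_star, ContinuousLinearMap.star_eq_adjoint, ContinuousLinearMap.adjoint_inner_right]

lemma StarAlgHom.inner_apply_star_mul_self (π : B →⋆ₐ[ℂ] (H →L[ℂ] H)) (b : B) (x y : H) :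
    ⟪x, π (star b * b) y⟫_ℂ = ⟪π b x, π b y⟫_ℂ := by
  rw [π.inner_apply_left, map_mul]
  rfl

/-- A cyclic representation whose vector functional is pure is irreducible. -/
theorem IsPureFunctional.isIrreducibleRep [PartialOrder B] [StarOrderedRing B]
    {f : B →ₚ[ℂ] ℂ} (hf : IsPureFunctional f)
    (π : B →⋆ₐ[ℂ] (H →L[ℂ] H)) (ξ : H) (hξ : Dense (Set.range fun b => π b ξ))
    (hfπ : ∀ b, f b = ⟪ξ, π b ξ⟫_ℂ) : IsIrreducibleRep π := by
  have hsa : ∀ T : H →L[ℂ] H, IsSelfAdjoint T → (∀ b, T * π b = π b * T) →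
      ∃ c : ℂ, T = c • (1 : H →L[ℂ] H) := by
    intro T hT hcomm
    have hTπ : ∀ b x, T (π b x) = π b (T x) := fun b x => DFunLike.congr_fun (hcomm b) x
    set r : ℝ := (‖T‖ + 1)⁻¹ with hr
    have hr0 : 0 < r := by positivity
    have hreal : ∀ x : H, ((⟪x, T x⟫_ℂ).re : ℂ) = ⟪x, T x⟫_ℂ := by
      intro x
      refine Complex.conj_eq_iff_re.mp ?_
      rw [inner_conj_symm]
      conv_lhs => rw [← hT.star_eq, ContinuousLinearMap.star_eq_adjoint,
        ContinuousLinearMap.adjoint_inner_left]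
    have hbound : ∀ x : H, |r * (⟪x, T x⟫_ℂ).re| ≤ ‖x‖ ^ 2 := by
      intro x
      have h1 : |(⟪x, T x⟫_ℂ).re| ≤ ‖x‖ * (‖T‖ * ‖x‖) :=
        (Complex.abs_re_le_norm _).trans ((norm_inner_le_norm _ _).trans
          (by gcongr; exact T.le_opNorm x))
      rw [abs_mul, abs_of_pos hr0]
      calc r * |(⟪x, T x⟫_ℂ).re| ≤ r * ((‖T‖ + 1) * ‖x‖ ^ 2) := by
            gcongr; nlinarith [sq_nonneg ‖x‖]
        _ = ‖x‖ ^ 2 := by rw [hr]; field_simp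
    -- This is the vector functional weighted by `(1 + rT)/2`. The choice of `r` puts that operator
    -- between 0 and 1, and it commutes with `π`, so `g₀` is positive and dominated by `f`.
    let g₀ : B →ₗ[ℂ] ℂ :=
      { toFun := fun b => 2⁻¹ * (⟪ξ, π b ξ⟫_ℂ + r * ⟪ξ, π b (T ξ)⟫_ℂ)
        map_add' := fun a b => by simp; ring
        map_smul' := fun c b => by simp; ring }
    have hg₀ : ∀ b, g₀ (star b * b) =
        ((2⁻¹ * (‖π b ξ‖ ^ 2 + r * (⟪π b ξ, T (π b ξ)⟫_ℂ).re) : ℝ) : ℂ) := by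
      intro b
      change 2⁻¹ * (⟪ξ, π (star b * b) ξ⟫_ℂ + r * ⟪ξ, π (star b * b) (T ξ)⟫_ℂ) = _
      rw [π.inner_apply_star_mul_self, π.inner_apply_star_mul_self, ← hTπ]
      push_cast
      rw [hreal, inner_self_eq_norm_sq_to_K]
      rfl
    obtain ⟨c, hc⟩ := hf (.ofStarMulSelf g₀ fun b => by
        rw [hg₀]
        have := abs_le.mp (hbound (π b ξ))
        exact_mod_cast (by linarith : 0 ≤ 2⁻¹ * (‖π b ξ‖ ^ 2 + r * (⟪π b ξ, T (π b ξ)⟫_ℂ).re)))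
      (fun a ha => by
        obtain ⟨b, rfl⟩ := CStarAlgebra.nonneg_iff_eq_star_mul_self.mp ha
        rw [PositiveLinearMap.ofStarMulSelf_apply, hg₀, hfπ, π.inner_apply_star_mul_self,
          show ⟪π b ξ, π b ξ⟫_ℂ = ((‖π b ξ‖ ^ 2 : ℝ) : ℂ) by
            rw [inner_self_eq_norm_sq_to_K]; push_cast; rfl]
        have := abs_le.mp (hbound (π b ξ))
        exact Complex.real_le_real.mpr (by linarith))
    have hc' : ∀ b, 2⁻¹ * (⟪ξ, π b ξ⟫_ℂ + r * ⟪ξ, π b (T ξ)⟫_ℂ) = c * ⟪ξ, π b ξ⟫_ℂ :=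
      fun b => (hc b).trans (congrArg (c * ·) (hfπ b))
    have hrC : (r : ℂ) ≠ 0 := by exact_mod_cast hr0.ne'
    set e : ℂ := (2 * c - 1) / r with he
    have hTξ : T ξ = e • ξ := by
      refine hξ.eq_of_inner_left (𝕜 := ℂ) ?_
      rintro _ ⟨b, rfl⟩
      change ⟪T ξ, π b ξ⟫_ℂ = ⟪e • ξ, π b ξ⟫_ℂ
      rw [← inner_conj_symm, ← inner_conj_symm (e • ξ)]
      congr 1
      rw [π.inner_apply_left, π.inner_apply_left, map_smul, inner_smul_right, he]
      field_simp
      linear_combination 2 * hc' (star b)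
    refine ⟨e, ?_⟩
    refine ContinuousLinearMap.ext fun x => ?_
    refine congrFun (Continuous.ext_on hξ T.continuous (e • (1 : H →L[ℂ] H)).continuous ?_) x
    rintro _ ⟨b, rfl⟩
    simp [hTπ, hTξ]
  -- A general `T` reduces to its self-adjoint and skew-adjoint parts, since the commutant is closed
  -- under adjoints.
  intro T hT
  have hT' : ∀ b, star T * π b = π b * star T := by
    intro b
    have := congrArg star (hT (star b))
    simpa [star_mul, ← map_star] using this.symm
  obtain ⟨c₁, h₁⟩ := hsa (T + star T) (.add_star_self T) fun b => by
    rw [add_mul, mul_add, hT, hT']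
  obtain ⟨c₂, h₂⟩ := hsa (Complex.I • (T - star T)) (by
      rw [isSelfAdjoint_iff, star_smul]; simp [← smul_neg]) fun b => by
    rw [smul_mul_assoc, mul_smul_comm, sub_mul, mul_sub, hT, hT']
  refine ⟨2⁻¹ * (c₁ - Complex.I * c₂), ?_⟩
  have h₃ : T - star T = (-Complex.I * c₂) • (1 : H →L[ℂ] H) := by
    rw [mul_smul, ← h₂, smul_smul]; simp
  have : T = (2⁻¹ : ℂ) • ((T + star T) + (T - star T)) := by
    rw [add_add_sub_cancel, ← two_smul ℂ T, smul_smul]; simp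
  rw [this, h₁, h₃, ← add_smul, smul_smul]
  congr 1; ring

end Irreducible

/-! ### The cyclic vector of the GNS representation. -/

section GNSVector

open scoped InnerProductSpace
open UniformSpace

variable {B : Type*} [CStarAlgebra B] [PartialOrder B] [StarOrderedRing B] (f : B →ₚ[ℂ] ℂ)

/-- The cyclic vector of the GNS representation. -/
noncomputable def PositiveLinearMap.gnsVector : f.GNS := (f.toPreGNS 1 : Completion f.PreGNS)

lemma PositiveLinearMap.gnsStarAlgHom_gnsVector (b : B) :
    f.gnsStarAlgHom b f.gnsVector = (f.toPreGNS b : Completion f.PreGNS) := by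
  change f.gnsNonUnitalStarAlgHom b (f.toPreGNS 1 : Completion f.PreGNS) = _
  rw [PositiveLinearMap.gnsNonUnitalStarAlgHom_apply_coe]
  simp

lemma PositiveLinearMap.dense_range_gnsStarAlgHom_gnsVector :
    Dense (Set.range fun b => f.gnsStarAlgHom b f.gnsVector) := by
  simp only [f.gnsStarAlgHom_gnsVector]
  exact (Completion.denseRange_coe (α := f.PreGNS)).comp f.toPreGNS.surjective.denseRange
    (Completion.continuous_coe _)

lemma PositiveLinearMap.inner_gnsVector (b : B) :
    f b = ⟪f.gnsVector, f.gnsStarAlgHom b f.gnsVector⟫_ℂ := by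
  rw [f.gnsStarAlgHom_gnsVector, gnsVector, Completion.inner_coe, f.preGNS_inner_def]
  simp

end GNSVector

/-! ### Schur's lemma and projections in the double commutant. -/

section Schur

variable {B : Type*} [CStarAlgebra B]
variable {H₁ : Type*} [NormedAddCommGroup H₁] [InnerProductSpace ℂ H₁] [CompleteSpace H₁]
variable {H₂ : Type*} [NormedAddCommGroup H₂] [InnerProductSpace ℂ H₂] [CompleteSpace H₂]

/-- The space of bounded operators intertwining two representations. -/
def intertwiners (π : B →⋆ₐ[ℂ] (H₁ →L[ℂ] H₁)) (ρ : B →⋆ₐ[ℂ] (H₂ →L[ℂ] H₂)) :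
    Submodule ℂ (H₁ →L[ℂ] H₂) where
  carrier := {T | ∀ b x, T (π b x) = ρ b (T x)}
  add_mem' hS hT b x := by simp [hS b x, hT b x]
  zero_mem' b x := by simp
  smul_mem' c T hT b x := by simp [hT b x]

lemma adjoint_mem_intertwiners {π : B →⋆ₐ[ℂ] (H₁ →L[ℂ] H₁)} {ρ : B →⋆ₐ[ℂ] (H₂ →L[ℂ] H₂)}
    {T : H₁ →L[ℂ] H₂} (hT : T ∈ intertwiners π ρ) :
    ContinuousLinearMap.adjoint T ∈ intertwiners ρ π := by
  intro b x
  refine ext_inner_left ℂ fun y => ?_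
  rw [ContinuousLinearMap.adjoint_inner_right, ← star_star b, ← ρ.inner_apply_left,
    ← π.inner_apply_left, ContinuousLinearMap.adjoint_inner_right, hT]

lemma IsIrreducibleRep.exists_smul_of_mem_intertwiners {π : B →⋆ₐ[ℂ] (H₁ →L[ℂ] H₁)}
    (hπ : IsIrreducibleRep π) {T : H₁ →L[ℂ] H₁} (hT : T ∈ intertwiners π π) :
    ∃ c : ℂ, ∀ x, T x = c • x := by
  obtain ⟨c, rfl⟩ := hπ T fun b => ContinuousLinearMap.ext fun x => hT b x
  exact ⟨c, fun x => rfl⟩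

/-- Schur's lemma: irreducible representations have at most one-dimensional spaces of
intertwiners. -/
theorem finiteDimensional_intertwiners {π : B →⋆ₐ[ℂ] (H₁ →L[ℂ] H₁)}
    {ρ : B →⋆ₐ[ℂ] (H₂ →L[ℂ] H₂)} (hπ : IsIrreducibleRep π) (hρ : IsIrreducibleRep ρ) :
    FiniteDimensional ℂ (intertwiners π ρ) := by
  by_cases h : intertwiners π ρ = ⊥
  · rw [h]; infer_instance
  obtain ⟨T, hT, hT0⟩ := Submodule.exists_mem_ne_zero_of_ne_bot h
  suffices intertwiners π ρ ≤ Submodule.span ℂ {T} from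
    Submodule.finiteDimensional_of_le this
  have hT' := adjoint_mem_intertwiners hT
  obtain ⟨c, hc⟩ := hρ.exists_smul_of_mem_intertwiners
    (T := T ∘L ContinuousLinearMap.adjoint T) fun b x => by simp [hT' b x, hT b]
  have hc0 : c ≠ 0 := by
    rintro rfl
    refine hT0 ?_
    have h0 : ContinuousLinearMap.adjoint T = 0 := by
      ext x
      have := hc x
      rw [zero_smul, ContinuousLinearMap.comp_apply] at this
      rw [zero_apply, ← inner_self_eq_zero (𝕜 := ℂ),
        ContinuousLinearMap.adjoint_inner_left, this, inner_zero_right]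
    rw [← ContinuousLinearMap.adjoint_adjoint T, h0, map_zero]
  -- With `T T⋆ = c` and `T⋆ S = e`, it follows that `S = c⁻¹ T T⋆ S = c⁻¹ e T`.
  intro S hS
  obtain ⟨e, he⟩ := hπ.exists_smul_of_mem_intertwiners
    (T := ContinuousLinearMap.adjoint T ∘L S) fun b x => by simp [hS b x, hT' b]
  refine Submodule.mem_span_singleton.mpr ⟨c⁻¹ * e, ?_⟩
  ext x
  have h1 := hc (S x)
  have h2 := he x
  simp only [ContinuousLinearMap.comp_apply] at h1 h2
  rw [h2, map_smul] at h1
  rw [smul_apply, mul_smul, h1, smul_smul, inv_mul_cancel₀ hc0, one_smul]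

/-- Invariance under the adjoint makes the orthogonal complement of `V` invariant under `T`, so `V`
reduces `T`. -/
lemma Submodule.commute_starProjection (V : Submodule ℂ H₁) [V.HasOrthogonalProjection]
    {T : H₁ →L[ℂ] H₁} (hT : ∀ x ∈ V, T x ∈ V)
    (hTadj : ∀ x ∈ V, ContinuousLinearMap.adjoint T x ∈ V) :
    V.starProjection * T = T * V.starProjection := by
  ext x
  refine V.eq_starProjection_of_mem_of_inner_eq_zero
    (hT _ (V.starProjection_apply_mem x)) fun w hw => ?_
  have : T x - (T * V.starProjection) x = T (x - V.starProjection x) := by simp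
  change inner ℂ (T x - (T * V.starProjection) x) w = 0
  rw [this, ← ContinuousLinearMap.adjoint_inner_right]
  exact V.starProjection_inner_eq_zero x _ (hTadj w hw)

/-- If the commutant of a representation is finite-dimensional, then every finite-dimensional
subspace invariant under a self-adjoint subalgebra `D` is contained in the range of a finite-rank
projection in the double commutant that commutes with the image of `D`. -/
theorem exists_isStarProjection_of_finiteDimensional_commutant (π : B →⋆ₐ[ℂ] (H₁ →L[ℂ] H₁))
    [FiniteDimensional ℂ (intertwiners π π)] (D : StarSubalgebra ℂ B) (W : Submodule ℂ H₁)
    [FiniteDimensional ℂ W] (hW : ∀ d ∈ D, ∀ w ∈ W, π d w ∈ W) :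
    ∃ P : H₁ →L[ℂ] H₁, IsStarProjection P ∧ FiniteDimensional ℂ P.range ∧
      P ∈ Set.centralizer (Set.centralizer (Set.range π)) ∧
      (∀ d ∈ D, P * π d = π d * P) ∧ ∀ w ∈ W, P w = w := by
  -- `V` is the saturation of `W` under the commutant. It remains `D`-invariant because the
  -- commutant commutes with `D`.
  let V : Submodule ℂ H₁ := Submodule.map₂ (ContinuousLinearMap.coeLM ℂ) (intertwiners π π) W
  have hV : V.FG := Submodule.FG.map₂ _ (Module.Finite.iff_fg.mp ‹_›) (Module.Finite.iff_fg.mp ‹_›)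
  have : FiniteDimensional ℂ V := Module.Finite.iff_fg.mpr hV
  have hmem : ∀ T ∈ intertwiners π π, ∀ w ∈ W, T w ∈ V := fun T hT w hw =>
    Submodule.apply_mem_map₂ (ContinuousLinearMap.coeLM ℂ) hT hw
  have hVle : ∀ S : H₁ →L[ℂ] H₁, (∀ T ∈ intertwiners π π, ∀ w ∈ W, S (T w) ∈ V) →
      ∀ x ∈ V, S x ∈ V := fun S hS x hx =>
    (Submodule.map₂_le (r := V.comap S.toLinearMap)).mpr hS hx
  have hVD : ∀ d ∈ D, ∀ x ∈ V, π d x ∈ V := fun d hd => hVle _ fun T hT w hw => by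
    rw [← hT]
    exact hmem T hT _ (hW d hd w hw)
  have hVC : ∀ S ∈ intertwiners π π, ∀ x ∈ V, S x ∈ V := fun S hS => hVle _ fun T hT w hw =>
    hmem (S ∘L T) (fun b x => by simp [hT b x, hS b]) w hw
  refine ⟨V.starProjection, isStarProjection_starProjection, ?_, ?_, fun d hd => ?_,
    fun w hw => ?_⟩
  · rw [Submodule.range_starProjection]; infer_instance
  · intro S hS
    have hS' : S ∈ intertwiners π π := fun b x => DFunLike.congr_fun (hS _ ⟨b, rfl⟩).symm x
    exact (V.commute_starProjection (hVC S hS')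
      (hVC _ (adjoint_mem_intertwiners hS'))).symm
  · refine V.commute_starProjection (hVD d hd) fun x hx => ?_
    rw [← ContinuousLinearMap.star_eq_adjoint, ← map_star]
    exact hVD _ (star_mem hd) x hx
  · rw [Submodule.starProjection_eq_self_iff]
    exact hmem 1 (fun b x => rfl) w hw

end Schur

/-! ### Finite direct sums of irreducible representations. -/

section DirectSum

variable {B : Type*} [CStarAlgebra B] {ι : Type*} [Fintype ι] {H : ι → Type*}
  [∀ i, NormedAddCommGroup (H i)] [∀ i, InnerProductSpace ℂ (H i)] [∀ i, CompleteSpace (H i)]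

/-- The direct sum of a finite family of representations. -/
noncomputable def directSumRep (π : ∀ i, B →⋆ₐ[ℂ] (H i →L[ℂ] H i)) :
    B →⋆ₐ[ℂ] (PiLp 2 H →L[ℂ] PiLp 2 H) where
  toFun b := (PiLp.continuousLinearEquiv 2 ℂ H).symm.toContinuousLinearMap ∘L
    ContinuousLinearMap.pi fun i => π i b ∘L PiLp.proj 2 H i
  map_one' := by ext; simp
  map_mul' a b := by ext; simp
  map_zero' := by ext; simp
  map_add' a b := by ext; simp
  commutes' c := by ext; simp [Algebra.algebraMap_eq_smul_one]
  map_star' b := by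
    rw [ContinuousLinearMap.star_eq_adjoint, ContinuousLinearMap.eq_adjoint_iff]
    intro x y
    simp only [PiLp.inner_apply]
    refine Finset.sum_congr rfl fun i _ => ?_
    simpa using (π i).inner_apply_left (star b) (x i) (y i)

@[simp]
lemma directSumRep_apply (π : ∀ i, B →⋆ₐ[ℂ] (H i →L[ℂ] H i)) (b : B) (x : PiLp 2 H) (i : ι) :
    directSumRep π b x i = π i b (x i) := rfl

lemma directSumRep_single [DecidableEq ι] (π : ∀ i, B →⋆ₐ[ℂ] (H i →L[ℂ] H i)) (b : B) (i : ι)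
    (x : H i) : directSumRep π b (PiLp.single 2 i x) = PiLp.single 2 i (π i b x) := by
  ext j
  rcases eq_or_ne j i with rfl | h
  · simp
  · simp [h]

/-- An operator in the commutant is a finite matrix of intertwiners, each block ranging over at most
a line. Equivalent summands are thus allowed, and the pure states need not be disjoint. -/
lemma finiteDimensional_commutant_directSumRep (π : ∀ i, B →⋆ₐ[ℂ] (H i →L[ℂ] H i))
    (hπ : ∀ i, IsIrreducibleRep (π i)) :
    FiniteDimensional ℂ (intertwiners (directSumRep π) (directSumRep π)) := by
  classical
  have := fun i j => finiteDimensional_intertwiners (hπ i) (hπ j)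
  let s : ∀ j, H j →L[ℂ] PiLp 2 H := fun j =>
    (PiLp.continuousLinearEquiv 2 ℂ H).symm.toContinuousLinearMap ∘L
      ContinuousLinearMap.single ℂ H j
  have hs : ∀ j x, s j x = PiLp.single 2 j x := fun j x => rfl
  let Φ : intertwiners (directSumRep π) (directSumRep π) →ₗ[ℂ]
      (∀ p : ι × ι, intertwiners (π p.1) (π p.2)) :=
    { toFun := fun T p => ⟨PiLp.proj 2 H p.2 ∘L T.1 ∘L s p.1, fun b x => by
        have := T.2 b (s p.1 x)
        rw [hs, directSumRep_single, ← hs] at this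
        simp [this, ← hs]⟩
      map_add' := fun S T => by ext; simp
      map_smul' := fun c T => by ext; simp }
  refine Module.Finite.of_injective Φ ((injective_iff_map_eq_zero Φ).mpr fun T hT => ?_)
  have h0 : ∀ j x, T.1 (PiLp.single 2 j x) = 0 := by
    intro j x
    ext i
    exact DFunLike.congr_fun (congrArg Subtype.val (congrFun hT (j, i))) x
  ext1
  ext1 x
  have hx : x = ∑ j, PiLp.single 2 j (x j) := by
    ext i
    simp [WithLp.ofLp_sum, Finset.sum_apply, Finset.sum_pi_single]
  rw [hx, map_sum]
  simp [h0]

/-- A finite family of irreducible representations with vectors generating finite-dimensional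
subspaces under a self-adjoint subalgebra `D` admits a finite-rank projection in the double
commutant of the direct sum that commutes with `D` and compresses no `D`-orbit. -/
theorem exists_isStarProjection_directSumRep (π : ∀ i, B →⋆ₐ[ℂ] (H i →L[ℂ] H i))
    (hπ : ∀ i, IsIrreducibleRep (π i)) (D : StarSubalgebra ℂ B) (ξ : ∀ i, H i)
    (W : ∀ i, Submodule ℂ (H i)) [∀ i, FiniteDimensional ℂ (W i)]
    (hW : ∀ i, ∀ d ∈ D, ∀ w ∈ W i, π i d w ∈ W i) (hξ : ∀ i, ξ i ∈ W i) :
    ∃ P : PiLp 2 H →L[ℂ] PiLp 2 H, IsStarProjection P ∧ FiniteDimensional ℂ P.range ∧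
      P ∈ Set.centralizer (Set.centralizer (Set.range (directSumRep π))) ∧
      (∀ d ∈ D, P * directSumRep π d = directSumRep π d * P) ∧
      ∀ i, ∀ d ∈ D, ‖π i d (ξ i)‖ ≤ ‖P * directSumRep π d * P‖ * ‖ξ i‖ := by
  classical
  have := finiteDimensional_commutant_directSumRep π hπ
  let U : Submodule ℂ (PiLp 2 H) :=
    (Submodule.pi Set.univ W).comap (WithLp.linearEquiv 2 ℂ (∀ i, H i)).toLinearMap
  have hmemU : ∀ x : PiLp 2 H, x ∈ U ↔ ∀ i, x i ∈ W i := by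
    intro x; simp [U, Submodule.mem_pi]
  have : FiniteDimensional ℂ U := by
    let Φ : U →ₗ[ℂ] (∀ i, W i) :=
      { toFun := fun x i => ⟨x.1 i, (hmemU x.1).mp x.2 i⟩
        map_add' := fun x y => rfl
        map_smul' := fun c x => rfl }
    refine Module.Finite.of_injective Φ fun x y hxy => ?_
    ext i
    exact congrArg Subtype.val (congrFun hxy i)
  obtain ⟨P, hP, hfin, hcent, hcomm, hfix⟩ :=
    exists_isStarProjection_of_finiteDimensional_commutant (directSumRep π) D U
      (fun d hd w hw => (hmemU _).mpr fun i => hW i d hd _ ((hmemU w).mp hw i))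
  refine ⟨P, hP, hfin, hcent, hcomm, fun i d hd => ?_⟩
  have hsU : ∀ w ∈ W i, PiLp.single 2 i w ∈ U := by
    intro w hw
    refine (hmemU _).mpr fun j => ?_
    rcases eq_or_ne j i with rfl | h
    · simpa using hw
    · simp [h]
  have h1 : (P * directSumRep π d * P) (PiLp.single 2 i (ξ i)) =
      PiLp.single 2 i (π i d (ξ i)) := by
    change P (directSumRep π d (P (PiLp.single 2 i (ξ i)))) = _
    rw [hfix _ (hsU _ (hξ i)), directSumRep_single, hfix _ (hsU _ (hW i d hd _ (hξ i)))]
  have h2 := (P * directSumRep π d * P).le_opNorm (PiLp.single 2 i (ξ i))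
  rwa [h1, PiLp.norm_single, PiLp.norm_single] at h2

end DirectSum

/-! ### From positive maps into finite dimensions to inner quasidiagonality. -/

section Criterion

open scoped InnerProductSpace

variable {B : Type u} [CStarAlgebra B] [PartialOrder B] [StarOrderedRing B]

/-- The image of a subspace `D` under a linear map that vanishes on `D ∩ ker Ψ` is
finite-dimensional if the target of `Ψ` is. -/
lemma finiteDimensional_map_of_ker_le {V K H : Type*} [AddCommGroup V] [Module ℂ V]
    [AddCommGroup K] [Module ℂ K] [FiniteDimensional ℂ K] [AddCommGroup H] [Module ℂ H]
    (D : Submodule ℂ V) (Ψ : V →ₗ[ℂ] K) (L : V →ₗ[ℂ] H)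
    (h : ∀ d ∈ D, Ψ d = 0 → L d = 0) : FiniteDimensional ℂ (D.map L) := by
  have hker : LinearMap.ker (Ψ.domRestrict D) ≤ LinearMap.ker (L.domRestrict D) := by
    rintro ⟨d, hd⟩ h0
    exact h d hd h0
  have hfin : FiniteDimensional ℂ (D ⧸ LinearMap.ker (Ψ.domRestrict D)) :=
    (Ψ.domRestrict D).quotKerEquivRange.symm.finiteDimensional
  have hrange : D.map L = LinearMap.range
      ((LinearMap.ker (Ψ.domRestrict D)).liftQ (L.domRestrict D) hker) := by
    rw [Submodule.range_liftQ]
    ext x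
    simp
  rw [hrange]
  infer_instance

lemma ContinuousLinearMap.exists_norm_eq_one_lt_norm_apply {K : Type*} [NormedAddCommGroup K]
    [NormedSpace ℂ K] (T : K →L[ℂ] K) {r : ℝ} (hr : 0 ≤ r) (hrT : r < ‖T‖) :
    ∃ η : K, ‖η‖ = 1 ∧ r < ‖T η‖ := by
  obtain ⟨x, hx1, hx⟩ := T.exists_lt_apply_of_lt_opNorm hrT
  have hx0 : 0 < ‖x‖ := by
    rw [norm_pos_iff]
    rintro rfl
    rw [map_zero, norm_zero] at hx
    linarith
  refine ⟨((‖x‖⁻¹ : ℝ) : ℂ) • x, ?_, ?_⟩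
  · rw [norm_smul]; simp [hx0.ne']
  · rw [map_smul, norm_smul, Complex.norm_real, norm_inv, norm_norm]
    refine hx.trans_le ?_
    rw [inv_mul_eq_div, le_div_iff₀ hx0]
    nlinarith [norm_nonneg (T x)]

/-- A unital positive map `Ψ` into operators that is multiplicative on `D` yields pure states whose
left kernel contains `D ∩ ker Ψ` and that nearly attain the norm of `Ψ d₀`. -/
lemma exists_isPureFunctional_of_positive {K : Type*} [NormedAddCommGroup K]
    [InnerProductSpace ℂ K] [CompleteSpace K] (Ψ : B →ₚ[ℂ] (K →L[ℂ] K)) (hΨ : Ψ 1 = 1)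
    (D : StarSubalgebra ℂ B) (hD : ∀ d ∈ D, ∀ e ∈ D, Ψ (d * e) = Ψ d * Ψ e)
    {d₀ : B} (hd₀ : d₀ ∈ D) {r : ℝ} (hr : 0 ≤ r) (hrd : r < ‖Ψ d₀‖) :
    ∃ f : B →ₚ[ℂ] ℂ, IsPureFunctional f ∧ f 1 = 1 ∧
      (∀ d ∈ D, Ψ d = 0 → f (star d * d) = 0) ∧ r ^ 2 ≤ (f (star d₀ * d₀)).re := by
  obtain ⟨η, hη, hrη⟩ := (Ψ d₀).exists_norm_eq_one_lt_norm_apply hr hrd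
  let f₀ : B →ₚ[ℂ] ℂ := .ofStarMulSelf
    { toFun := fun b => ⟪η, Ψ b η⟫_ℂ
      map_add' := fun a b => by simp
      map_smul' := fun c b => by simp } fun b =>
    ((ContinuousLinearMap.nonneg_iff_isPositive _).mp
      (Ψ.map_nonneg (star_mul_self_nonneg b))).inner_nonneg_right η
  have hf₀ : ∀ b, f₀ b = ⟪η, Ψ b η⟫_ℂ := fun b => rfl
  have hf₀D : ∀ d ∈ D, f₀ (star d * d) = ((‖Ψ d η‖ ^ 2 : ℝ) : ℂ) := by
    intro d hd
    rw [hf₀, hD _ (star_mem hd) _ hd, map_star]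
    change ⟪η, star (Ψ d) (Ψ d η)⟫_ℂ = _
    rw [ContinuousLinearMap.star_eq_adjoint, ContinuousLinearMap.adjoint_inner_right,
      inner_self_eq_norm_sq_to_K]
    push_cast
    rfl
  obtain ⟨f, hf, hf1, hfZ, hfd⟩ := exists_isPureFunctional
    {z | ∃ d ∈ D, Ψ d = 0 ∧ z = star d * d} (by
      rintro _ ⟨d, -, -, rfl⟩
      exact star_mul_self_nonneg d) (star d₀ * d₀) f₀ (by
      rw [hf₀, hΨ, one_apply_eq_self, inner_self_eq_norm_sq_to_K, hη]; simp) (by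
      rintro _ ⟨d, hd, hd0, rfl⟩
      rw [hf₀D d hd, hd0]; simp)
  refine ⟨f, hf, hf1, fun d hd h0 => hfZ _ ⟨d, hd, h0, rfl⟩, le_trans ?_ hfd⟩
  rw [hf₀D d₀ hd₀, Complex.ofReal_re]
  gcongr

/-- Finitely many pure states whose left kernels contain `D ∩ ker Ψ`, with `Ψ` a linear map into a
finite-dimensional space, are realized by a representation and a finite-rank projection in its
double commutant that commutes with `D`. -/
theorem exists_rep_of_isPureFunctional {ι : Type} [Fintype ι] (f : ι → B →ₚ[ℂ] ℂ)
    (hpure : ∀ i, IsPureFunctional (f i)) (hf1 : ∀ i, f i 1 = 1) (D : StarSubalgebra ℂ B)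
    {K : Type*} [AddCommGroup K] [Module ℂ K] [FiniteDimensional ℂ K] (Ψ : B →ₗ[ℂ] K)
    (hfD : ∀ i, ∀ d ∈ D, Ψ d = 0 → f i (star d * d) = 0) :
    ∃ (H : Type u) (_ : NormedAddCommGroup H) (_ : InnerProductSpace ℂ H) (_ : CompleteSpace H)
      (ρ : B →⋆ₐ[ℂ] (H →L[ℂ] H)) (P : H →L[ℂ] H), IsStarProjection P ∧
      FiniteDimensional ℂ P.range ∧ P ∈ Set.centralizer (Set.centralizer (Set.range ρ)) ∧
      (∀ d ∈ D, P * ρ d = ρ d * P) ∧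
      ∀ i, ∀ d ∈ D, (f i (star d * d)).re ≤ ‖P * ρ d * P‖ ^ 2 := by
  let π : ∀ i : ι, B →⋆ₐ[ℂ] ((f i).GNS →L[ℂ] (f i).GNS) := fun i => (f i).gnsStarAlgHom
  let ξ : ∀ i : ι, (f i).GNS := fun i => (f i).gnsVector
  have hπ : ∀ i, IsIrreducibleRep (π i) := fun i => (hpure i).isIrreducibleRep (π i) (ξ i)
    (f i).dense_range_gnsStarAlgHom_gnsVector (f i).inner_gnsVector
  have hnorm : ∀ i b, f i (star b * b) = ((‖π i b (ξ i)‖ ^ 2 : ℝ) : ℂ) := by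
    intro i b
    rw [(f i).inner_gnsVector, StarAlgHom.inner_apply_star_mul_self,
      inner_self_eq_norm_sq_to_K]
    push_cast
    rfl
  have hξ1 : ∀ i, ‖ξ i‖ = 1 := by
    intro i
    have := hnorm i 1
    rw [star_one, one_mul, hf1, map_one, one_apply_eq_self] at this
    have h2 : ‖ξ i‖ ^ 2 = 1 := by exact_mod_cast this.symm
    exact (pow_eq_one_iff_of_nonneg (norm_nonneg _) two_ne_zero).mp h2
  let L : ∀ i : ι, B →ₗ[ℂ] (f i).GNS := fun i =>
    { toFun := fun b => π i b (ξ i)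
      map_add' := fun a b => by simp
      map_smul' := fun c b => by simp }
  -- The orbit `π i (D) ξ i`, finite-dimensional because `d ↦ π i d (ξ i)` vanishes on `D ∩ ker Ψ`.
  let W : ∀ i : ι, Submodule ℂ (f i).GNS := fun i =>
    (Subalgebra.toSubmodule D.toSubalgebra).map (L i)
  have hWfin : ∀ i, FiniteDimensional ℂ (W i) := by
    intro i
    refine finiteDimensional_map_of_ker_le _ Ψ (L i) fun d hd h0 => ?_
    have h1 := hnorm i d
    rw [hfD i d hd h0] at h1
    have h2 : ‖π i d (ξ i)‖ ^ 2 = 0 := by exact_mod_cast h1.symm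
    exact norm_eq_zero.mp (pow_eq_zero_iff two_ne_zero |>.mp h2)
  obtain ⟨P, hP, hPfin, hPcent, hPD, hPξ⟩ := exists_isStarProjection_directSumRep π hπ D ξ W
    (by
      rintro i d hd _ ⟨e, he, rfl⟩
      exact ⟨d * e, D.mul_mem hd he, by simp [L]⟩)
    (fun i => ⟨1, D.one_mem, by simp [L]⟩)
  refine ⟨PiLp 2 fun i => (f i).GNS, inferInstance, inferInstance, inferInstance,
    directSumRep π, P, hP, hPfin, hPcent, hPD, fun i d hd => ?_⟩
  have h1 := hPξ i d hd
  rw [hξ1, mul_one] at h1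
  rw [hnorm, Complex.ofReal_re]
  gcongr

/-- A criterion for inner quasidiagonality in terms of unital positive maps into finite-dimensional
operator algebras that are almost isometric and multiplicative on almost everything. -/
theorem innerQuasidiagonal_of_positive_maps
    (h : ∀ (n : ℕ) (x : Fin n → B) (ε : ℝ), 0 < ε →
      ∃ (K : Type v) (_ : NormedAddCommGroup K) (_ : InnerProductSpace ℂ K)
        (_ : FiniteDimensional ℂ K) (_ : CompleteSpace K) (Ψ : B →ₚ[ℂ] (K →L[ℂ] K))
        (D : StarSubalgebra ℂ B), Ψ 1 = 1 ∧ (∀ d ∈ D, ∀ e ∈ D, Ψ (d * e) = Ψ d * Ψ e) ∧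
        ∀ i, (∃ d ∈ D, ‖x i - d‖ < ε) ∧ ‖x i‖ - ε < ‖Ψ (x i)‖) :
    InnerQuasidiagonal B := by
  intro n x ε hε
  -- Error budget in units of `ε / 8`: passing from `x i` to `Ψ (d i)` loses at most 1 + 4 units,
  -- rounded up to 6, and returning from `d i` to `x i` loses one more.
  obtain ⟨K, _, _, _, _, Ψ, D, hΨ, hD, hx⟩ := h n x (ε / 8) (by positivity)
  choose d hdD hd using fun i => (hx i).1
  have hxΨ := fun i => (hx i).2
  set δ := ε / 8 with hδ
  have hlt : ∀ i, ‖x i‖ - 6 * δ < ‖Ψ (d i)‖ := by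
    intro i
    have h1 := Ψ.norm_apply_le_four_mul (x i - d i)
    have h2 : ‖Ψ 1‖ ≤ 1 := by rw [hΨ]; exact ContinuousLinearMap.norm_id_le
    have h3 : ‖Ψ (x i)‖ ≤ ‖Ψ (d i)‖ + ‖Ψ (x i - d i)‖ := by
      rw [map_sub]; exact norm_le_norm_add_norm_sub' _ _
    have h4 : 4 * ‖Ψ 1‖ * ‖x i - d i‖ ≤ 4 * 1 * δ := by
      gcongr
      exact (hd i).le
    linarith [hxΨ i]
  -- Only these indices need a pure state; for the others `‖x i‖ - ε` is already negative.
  let ι := {i : Fin n // 0 ≤ ‖x i‖ - 6 * δ}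
  choose f hpure hf1 hfD hfr using fun i : ι =>
    exists_isPureFunctional_of_positive Ψ hΨ D hD (hdD i.1) i.2 (hlt i.1)
  obtain ⟨H, _, _, _, ρ, P, hP, hPfin, hPcent, hPD, hPf⟩ :=
    exists_rep_of_isPureFunctional f hpure hf1 D Ψ.toLinearMap hfD
  refine ⟨H, inferInstance, inferInstance, inferInstance,
    (ρ : B →⋆ₙₐ[ℂ] _), P, hP, hPfin, hPcent, fun i => ?_⟩
  change ‖P * ρ (x i) - ρ (x i) * P‖ < ε ∧ ‖x i‖ - ε < ‖P * ρ (x i) * P‖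
  have hPn : ‖P‖ ≤ 1 := hP.norm_le
  have hρn : ‖ρ (x i - d i)‖ ≤ δ := (NonUnitalStarAlgHom.norm_apply_le ρ _).trans (hd i).le
  have hδ0 : 0 < δ := by positivity
  constructor
  · have : P * ρ (x i) - ρ (x i) * P = P * ρ (x i - d i) - ρ (x i - d i) * P := by
      rw [map_sub, mul_sub, sub_mul, hPD _ (hdD i)]; abel
    rw [this]
    calc ‖P * ρ (x i - d i) - ρ (x i - d i) * P‖
        ≤ ‖P‖ * ‖ρ (x i - d i)‖ + ‖ρ (x i - d i)‖ * ‖P‖ :=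
          (norm_sub_le _ _).trans (add_le_add (norm_mul_le _ _) (norm_mul_le _ _))
      _ ≤ 1 * δ + δ * 1 := by gcongr
      _ < ε := by linarith
  · by_cases hi : 0 ≤ ‖x i‖ - 6 * δ
    · have h3 : ‖x i‖ - 6 * δ ≤ ‖P * ρ (d i) * P‖ :=
        (abs_le_of_sq_le_sq' ((hfr ⟨i, hi⟩).trans (hPf ⟨i, hi⟩ _ (hdD i))) (norm_nonneg _)).2
      have h4 : P * ρ (d i) * P = P * ρ (x i) * P - P * ρ (x i - d i) * P := by
        rw [map_sub, mul_sub, sub_mul]; abel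
      have h5 : ‖P * ρ (x i - d i) * P‖ ≤ 1 * δ * 1 :=
        (norm_mul_le _ _).trans (by
          gcongr
          exact (norm_mul_le _ _).trans (by gcongr))
      have h6 := norm_sub_le (P * ρ (x i) * P) (P * ρ (x i - d i) * P)
      rw [← h4] at h6
      linarith
    · push Not at hi
      linarith [norm_nonneg (P * ρ (x i) * P)]

end Criterion

/-! ### Multiplicative domains of completely positive maps. -/

section MultiplicativeDomain

lemma CStarAlgebra.exists_eq_star_mul_self {F : Type*} [CStarAlgebra F] [PartialOrder F]
    [StarOrderedRing F] {x : F} (hx : 0 ≤ x) : ∃ y : F, x = star y * y :=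
  CStarAlgebra.nonneg_iff_eq_star_mul_self.mp hx

lemma CStarMatrix.apply_eq_zero_of_nonneg {C : Type*} [CStarAlgebra C] [PartialOrder C]
    [StarOrderedRing C] {n : Type*} [Fintype n] [DecidableEq n] {N : CStarMatrix n n C}
    (hN : 0 ≤ N) {i : n} (hi : N i i = 0) (j : n) : N i j = 0 := by
  obtain ⟨Y, rfl⟩ := CStarAlgebra.exists_eq_star_mul_self hN
  rw [CStarMatrix.mul_apply] at hi ⊢
  simp only [CStarMatrix.star_apply] at hi ⊢
  have h0 := (Finset.sum_eq_zero_iff_of_nonneg fun u _ => star_mul_self_nonneg (Y u i)).mp hi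
  refine Finset.sum_eq_zero fun u hu => ?_
  rw [(CStarRing.star_mul_self_eq_zero_iff _).mp (h0 u hu), star_zero, zero_mul]

variable {A : Type*} [CStarAlgebra A] [PartialOrder A] [StarOrderedRing A]
  {C : Type*} [CStarAlgebra C] [PartialOrder C] [StarOrderedRing C]

/-- Choi's theorem on multiplicative domains, one-sided version. -/
lemma CompletelyPositiveMap.map_star_mul_of_eq (φ : A →CP C) (h1 : φ 1 = 1) {a : A}
    (ha : φ (star a * a) = star (φ a) * φ a) (b : A) :
    φ (star a * b) = star (φ a) * φ b := by
  have hstar : ∀ x, φ (star x) = star (φ x) := map_star φ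
  -- `R⋆ R` is the Gram matrix of the row `(a, 1, b)`. After applying `φ` and conjugating by `W`,
  -- the corner entry is `φ(a⋆a) - φ(a)⋆φ(a) = 0`, so positivity forces the `(0, 2)` entry `φ(a⋆b) -
  -- φ(a)⋆φ(b)` to vanish.
  let R : CStarMatrix (Fin 3) (Fin 3) A := CStarMatrix.ofMatrix !![a, 1, b; 0, 0, 0; 0, 0, 0]
  let W : CStarMatrix (Fin 3) (Fin 3) C :=
    CStarMatrix.ofMatrix !![1, 0, 0; -φ a, 0, 0; 0, 0, 1]
  have hpos := star_left_conjugate_nonneg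
    (φ.map_cstarMatrix_nonneg (star R * R) (star_mul_self_nonneg R)) W
  have h00 : (star W * (star R * R).map φ * W) 0 0 = 0 := by
    simp [CStarMatrix.mul_apply, CStarMatrix.star_apply, Fin.sum_univ_three, R, W, ha, h1, hstar]
  have h02 := CStarMatrix.apply_eq_zero_of_nonneg hpos h00 2
  simp [CStarMatrix.mul_apply, CStarMatrix.star_apply, Fin.sum_univ_three, R, W, h1] at h02
  exact sub_eq_zero.mp (by rw [sub_eq_add_neg]; exact h02)

lemma CompletelyPositiveMap.map_mul_of_mem_multiplicativeDomain (φ : A →CP C) (h1 : φ 1 = 1)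
    {a : A} (ha : a ∈ multiplicativeDomain φ) (b : A) : φ (a * b) = φ a * φ b := by
  have := φ.map_star_mul_of_eq h1 (a := star a) (by simpa [map_star] using ha.2) b
  simpa [map_star] using this

lemma CompletelyPositiveMap.map_mul_of_mem_multiplicativeDomain' (φ : A →CP C) (h1 : φ 1 = 1)
    {a : A} (ha : a ∈ multiplicativeDomain φ) (b : A) : φ (b * a) = φ b * φ a := by
  have := congrArg star (φ.map_star_mul_of_eq h1 ha.1 (star b))
  simpa [← map_star] using this

/-- The multiplicative domain of a unital completely positive map, as a ⋆-subalgebra. -/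
noncomputable def CompletelyPositiveMap.domain (φ : A →CP C) (h1 : φ 1 = 1) :
    StarSubalgebra ℂ A where
  carrier := multiplicativeDomain φ
  mul_mem' {a b} ha hb := by
    have l := fun x => φ.map_mul_of_mem_multiplicativeDomain h1 ha x
    have l' := fun x => φ.map_mul_of_mem_multiplicativeDomain' h1 hb x
    have m := fun x => φ.map_mul_of_mem_multiplicativeDomain h1 hb x
    have m' := fun x => φ.map_mul_of_mem_multiplicativeDomain' h1 ha x
    constructor
    · rw [← mul_assoc, l', m', l, map_star, l, mul_assoc]
    · rw [mul_assoc, l, m, map_star, l, mul_assoc]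
  add_mem' {a b} ha hb := by
    have l := fun x => φ.map_mul_of_mem_multiplicativeDomain h1 ha x
    have l' := fun x => φ.map_mul_of_mem_multiplicativeDomain' h1 hb x
    have m := fun x => φ.map_mul_of_mem_multiplicativeDomain h1 hb x
    have m' := fun x => φ.map_mul_of_mem_multiplicativeDomain' h1 ha x
    constructor
    · simp only [mul_add, map_add, l', m', ← map_star, star_add, add_mul]
    · simp only [add_mul, map_add, l, m, ← map_star, star_add, mul_add]
  algebraMap_mem' c := by
    simp [multiplicativeDomain, Algebra.algebraMap_eq_smul_one, h1]
  star_mem' {a} ha := by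
    refine ⟨?_, ?_⟩
    · simpa [map_star] using ha.2
    · simpa [map_star] using ha.1

end MultiplicativeDomain

/-! ### Asymptotically multiplicative and faithful implies asymptotically isometric. -/

section AlmostIsometric

/-- Spectral cut-off: above the level `c`, a positive element is invertible with inverse of norm at
most `c⁻¹`. -/
lemma CStarAlgebra.exists_mul_mul_eq_of_lt_norm {F : Type*} [CStarAlgebra F] [PartialOrder F]
    [StarOrderedRing F] {a : F} (ha : 0 ≤ a) {c : ℝ} (hc : 0 < c) (hca : c < ‖a‖) :
    ∃ y z : F, 0 ≤ y ∧ ‖y‖ ≤ c⁻¹ ∧ z ≠ 0 ∧ y * a * z = z := by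
  have hsa : IsSelfAdjoint a := .of_nonneg ha
  have : Nontrivial F := nontrivial_of_ne a 0 (by rintro rfl; simp at hca; linarith)
  have hmax : ∀ t : ℝ, max t c ≠ 0 := fun t => (lt_of_lt_of_le hc (le_max_right t c)).ne'
  have hg : Continuous fun t : ℝ => (max t c)⁻¹ :=
    (continuous_id.max continuous_const).inv₀ hmax
  have hh : Continuous fun t : ℝ => max (t - c) 0 := by fun_prop
  refine ⟨cfc (fun t : ℝ => (max t c)⁻¹) a, cfc (fun t : ℝ => max (t - c) 0) a, ?_, ?_, ?_, ?_⟩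
  · refine cfc_nonneg fun t _ => inv_nonneg.mpr (hc.le.trans (le_max_right t c))
  · refine norm_cfc_le (inv_nonneg.mpr hc.le) fun t _ => ?_
    rw [Real.norm_of_nonneg (inv_nonneg.mpr (hc.le.trans (le_max_right t c)))]
    exact inv_anti₀ hc (le_max_right t c)
  · intro h0
    have h1 := norm_apply_le_norm_cfc (fun t : ℝ => max (t - c) 0) a
      (CStarAlgebra.norm_mem_spectrum_of_nonneg ha) hh.continuousOn hsa
    rw [h0, norm_zero, Real.norm_of_nonneg (le_max_right _ _)] at h1
    linarith [le_max_left (‖a‖ - c) 0]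
  · nth_rewrite 2 [← cfc_id ℝ a]
    rw [← cfc_mul _ _ a hg.continuousOn continuousOn_id,
      ← cfc_mul (fun t : ℝ => (max t c)⁻¹ * id t) _ a (hg.mul continuous_id).continuousOn
        hh.continuousOn]
    refine cfc_congr fun t _ => ?_
    simp only [id_eq]
    rcases le_total t c with h | h
    · simp [h]
    · rw [max_eq_left h, inv_mul_cancel₀ (by linarith), one_mul]

/-- An asymptotically multiplicative sequence of unital positive maps that is asymptotically
bounded away from zero on each nonzero element is asymptotically norm-increasing. -/
theorem eventually_lt_norm_of_asymptotically_multiplicative {F : Type*} [CStarAlgebra F]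
    [PartialOrder F] [StarOrderedRing F] {C : ℕ → Type*} [∀ n, CStarAlgebra (C n)]
    [∀ n, PartialOrder (C n)] [∀ n, StarOrderedRing (C n)] (Ψ : ∀ n, F →ₚ[ℂ] C n)
    (hΨ : ∀ n, ‖Ψ n 1‖ ≤ 1)
    (hpos : ∀ z, z ≠ 0 → ∃ δ > 0, ∀ᶠ n in atTop, δ ≤ ‖Ψ n z‖)
    (hmul : ∀ x y, Tendsto (fun n => ‖Ψ n (x * y) - Ψ n x * Ψ n y‖) atTop (𝓝 0))
    (x : F) {c : ℝ} (hc : c < ‖x‖) : ∀ᶠ n in atTop, c < ‖Ψ n x‖ := by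
  rcases lt_or_ge c 0 with hc0 | hc0
  · exact .of_forall fun n => hc0.trans_le (norm_nonneg _)
  have hcx : c ^ 2 < ‖star x * x‖ := by
    rw [CStarRing.norm_star_mul_self, ← sq]; gcongr
  obtain ⟨e, hce, hex⟩ := exists_between hcx
  have he0 : 0 < e := (sq_nonneg c).trans_lt hce
  obtain ⟨y, z, hy0, hy, hz0, hyz⟩ :=
    CStarAlgebra.exists_mul_mul_eq_of_lt_norm (star_mul_self_nonneg x) he0 hex
  obtain ⟨δ, hδ, hδz⟩ := hpos z hz0
  set κ := 1 - e⁻¹ * c ^ 2 with hκ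
  have hκ0 : 0 < κ := by
    rw [hκ, sub_pos, inv_mul_lt_iff₀ he0]; linarith
  have hlim : Tendsto (fun n => ‖Ψ n (y * (star x * x) * z) - Ψ n (y * (star x * x)) * Ψ n z‖
      + ‖Ψ n (y * (star x * x)) - Ψ n y * Ψ n (star x * x)‖ * (4 * ‖z‖)
      + e⁻¹ * ‖Ψ n (star x * x) - Ψ n (star x) * Ψ n x‖ * (4 * ‖z‖)) atTop (𝓝 0) := by
    simpa using ((hmul (y * (star x * x)) z).add ((hmul y (star x * x)).mul_const _)).add
      (((hmul (star x) x).const_mul e⁻¹).mul_const (4 * ‖z‖))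
  filter_upwards [hδz, hlim.eventually_lt_const (mul_pos hκ0 hδ)] with n hn hsmall
  -- If `‖Ψ n x‖ ≤ c`, then `z = y x⋆x z` makes `Ψ n z` nearly equal to a product of norm at most
  -- `e⁻¹ c² ‖Ψ n z‖`. As `e⁻¹ c² < 1`, this contradicts `‖Ψ n z‖ ≥ δ` once the multiplicativity
  -- errors are below `κ δ`.
  by_contra! hcon
  have hz : ‖Ψ n z‖ ≤ 4 * ‖z‖ := by
    refine ((Ψ n).norm_apply_le_four_mul z).trans ?_
    have := mul_le_mul_of_nonneg_right (hΨ n) (norm_nonneg z)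
    linarith
  have hyn : ‖Ψ n y‖ ≤ e⁻¹ := by
    refine ((Ψ n).norm_apply_le_of_nonneg y hy0).trans ?_
    calc ‖Ψ n 1‖ * ‖y‖ ≤ 1 * e⁻¹ := by gcongr; exact hΨ n
      _ = e⁻¹ := one_mul _
  have hx : ‖Ψ n (star x) * Ψ n x‖ ≤ c ^ 2 := by
    rw [map_star, CStarRing.norm_star_mul_self, ← sq]
    gcongr
  have hdec : Ψ n z = (Ψ n (y * (star x * x) * z) - Ψ n (y * (star x * x)) * Ψ n z)
      + (Ψ n (y * (star x * x)) - Ψ n y * Ψ n (star x * x)) * Ψ n z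
      + Ψ n y * (Ψ n (star x * x) - Ψ n (star x) * Ψ n x) * Ψ n z
      + Ψ n y * (Ψ n (star x) * Ψ n x) * Ψ n z := by
    nth_rewrite 1 [← hyz]
    noncomm_ring
  have hle : ‖Ψ n z‖ ≤ ‖Ψ n (y * (star x * x) * z) - Ψ n (y * (star x * x)) * Ψ n z‖
      + ‖Ψ n (y * (star x * x)) - Ψ n y * Ψ n (star x * x)‖ * (4 * ‖z‖)
      + e⁻¹ * ‖Ψ n (star x * x) - Ψ n (star x) * Ψ n x‖ * (4 * ‖z‖)
      + e⁻¹ * c ^ 2 * ‖Ψ n z‖ := by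
    conv_lhs => rw [hdec]
    refine (norm_add_le _ _).trans (add_le_add ((norm_add_le _ _).trans (add_le_add
      ((norm_add_le _ _).trans (add_le_add le_rfl ?_)) ?_)) ?_)
    · refine (norm_mul_le _ _).trans ?_
      gcongr
    · refine (norm_mul_le _ _).trans ?_
      gcongr
      refine (norm_mul_le _ _).trans ?_
      gcongr
    · refine (norm_mul_le _ _).trans ?_
      gcongr
      refine (norm_mul_le _ _).trans ?_
      gcongr
  have : κ * δ ≤ κ * ‖Ψ n z‖ := by gcongr
  have : κ * ‖Ψ n z‖ = ‖Ψ n z‖ - e⁻¹ * c ^ 2 * ‖Ψ n z‖ := by rw [hκ]; ring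
  linarith

end AlmostIsometric

/-! ### Matrix amplifications of completely positive maps. -/

section Amplification

lemma CStarMatrix.tendsto_of_entries {A G : Type*} [NonUnitalCStarAlgebra A]
    {M : ℕ → CStarMatrix G G A} {N : CStarMatrix G G A}
    (h : ∀ s t, Tendsto (fun n => M n s t) atTop (𝓝 (N s t))) : Tendsto M atTop (𝓝 N) :=
  tendsto_pi_nhds.mpr fun s => tendsto_pi_nhds.mpr fun t => h s t

variable {G : Type*} [Fintype G] [DecidableEq G]

/-- The action of `M_G(M_k(ℂ))` on the Hilbert space `ℂ^(G × k)`. -/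
noncomputable def blockMatrixRep (G : Type*) [Fintype G] [DecidableEq G] (k : ℕ) :
    CStarMatrix G G (MatrixAlgebra k) →⋆ₐ[ℂ]
      (EuclideanSpace ℂ (G × Fin k) →L[ℂ] EuclideanSpace ℂ (G × Fin k)) :=
  (Matrix.toEuclideanCLM (n := G × Fin k) (𝕜 := ℂ) :
    Matrix (G × Fin k) (G × Fin k) ℂ →⋆ₐ[ℂ] _).comp
  { toFun := fun M => Matrix.of fun p q => M p.1 q.1 p.2 q.2
    map_one' := by
      ext p q
      by_cases h1 : p.1 = q.1 <;> by_cases h2 : p.2 = q.2 <;>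
        simp [CStarMatrix.one_apply, Matrix.one_apply, Prod.ext_iff, h1, h2]
    map_mul' := fun M N => by
      ext p q
      simp only [Matrix.of_apply, CStarMatrix.mul_apply, Matrix.mul_apply,
        Fintype.sum_prod_type]
      exact (Matrix.sum_apply _ _ _ _).trans rfl
    map_zero' := by ext; rfl
    map_add' := fun M N => by ext; rfl
    commutes' := fun c => by
      ext p q
      by_cases h1 : p.1 = q.1 <;> by_cases h2 : p.2 = q.2 <;>
        simp [Algebra.algebraMap_eq_smul_one, CStarMatrix.one_apply, Matrix.one_apply,
          Prod.ext_iff, h1, h2]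
    map_star' := fun M => by ext; rfl }

lemma blockMatrixRep_injective (k : ℕ) : Function.Injective (blockMatrixRep G k) := by
  intro M N h
  have h' := (Matrix.toEuclideanCLM (n := G × Fin k) (𝕜 := ℂ)).injective h
  ext s t i j
  exact congrFun (congrFun h' (s, i)) (t, j)

lemma norm_blockMatrixRep (k : ℕ) (M : CStarMatrix G G (MatrixAlgebra k)) :
    ‖blockMatrixRep G k M‖ = ‖M‖ :=
  NonUnitalStarAlgHom.norm_map _ (blockMatrixRep_injective k) M

variable {A : Type*} [CStarAlgebra A] [PartialOrder A] [StarOrderedRing A]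
  {C : Type*} [CStarAlgebra C] [PartialOrder C] [StarOrderedRing C]

/-- The entrywise amplification of a completely positive map to matrices. -/
noncomputable def CompletelyPositiveMap.amplify (G : Type*) [Fintype G] [DecidableEq G]
    (φ : A →CP C) : CStarMatrix G G A →ₚ[ℂ] CStarMatrix G G C :=
  .mk₀ (CStarMatrix.mapₗ φ.toLinearMap) fun M hM => φ.map_cstarMatrix_nonneg M hM

lemma CompletelyPositiveMap.amplify_apply (φ : A →CP C) (M : CStarMatrix G G A) (s t : G) :
    φ.amplify G M s t = φ (M s t) := rfl

lemma CompletelyPositiveMap.amplify_one (φ : A →CP C) (h1 : φ 1 = 1) : φ.amplify G 1 = 1 := by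
  ext s t
  rw [φ.amplify_apply, CStarMatrix.one_apply, CStarMatrix.one_apply]
  split_ifs <;> simp [h1]

lemma CompletelyPositiveMap.amplify_mul (φ : A →CP C) (h1 : φ 1 = 1) (M N : CStarMatrix G G A)
    (hN : ∀ s t, N s t ∈ multiplicativeDomain φ) :
    φ.amplify G (M * N) = φ.amplify G M * φ.amplify G N := by
  ext s t
  rw [φ.amplify_apply, CStarMatrix.mul_apply, CStarMatrix.mul_apply, map_sum]
  exact Finset.sum_congr rfl fun u _ => φ.map_mul_of_mem_multiplicativeDomain' h1 (hN u t) _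

/-- The matrices with entries in a ⋆-subalgebra. -/
def CStarMatrix.entriesIn (G : Type*) [Fintype G] [DecidableEq G] (D : StarSubalgebra ℂ A) :
    StarSubalgebra ℂ (CStarMatrix G G A) where
  carrier := {M | ∀ s t, M s t ∈ D}
  mul_mem' hM hN s t := by
    rw [CStarMatrix.mul_apply]
    exact sum_mem fun u _ => mul_mem (hM s u) (hN u t)
  add_mem' hM hN s t := add_mem (hM s t) (hN s t)
  algebraMap_mem' c s t := by
    rw [Algebra.algebraMap_eq_smul_one, CStarMatrix.smul_apply, CStarMatrix.one_apply]
    split_ifs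
    · exact D.smul_mem (one_mem D) c
    · exact D.smul_mem (zero_mem D) c
  star_mem' hM s t := by
    rw [CStarMatrix.star_apply]
    exact star_mem (hM t s)

lemma exists_seq_tendsto_of_tendsto_infDist {X : Type*} [PseudoMetricSpace X] {S : ℕ → Set X}
    (hS : ∀ n, (S n).Nonempty) {a : X}
    (h : Tendsto (fun n => Metric.infDist a (S n)) atTop (𝓝 0)) :
    ∃ d : ℕ → X, (∀ n, d n ∈ S n) ∧ Tendsto d atTop (𝓝 a) := by
  have hlt : ∀ n : ℕ, ∃ y ∈ S n, dist a y < Metric.infDist a (S n) + 1 / ((n : ℝ) + 1) :=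
    fun n => (Metric.infDist_lt_iff (hS n)).mp (by
      have : 0 < 1 / ((n : ℝ) + 1) := by positivity
      linarith)
  choose d hd hdist using hlt
  refine ⟨d, hd, tendsto_iff_dist_tendsto_zero.mpr ?_⟩
  refine squeeze_zero (fun n => dist_nonneg) (fun n => ?_)
    (by simpa only [add_zero] using h.add tendsto_one_div_add_atTop_nhds_zero_nat)
  rw [dist_comm]
  exact (hdist n).le

/-- The multiplicativity defect depends only on `y - d`; its two terms contribute 4 and 4 · 4. -/
lemma PositiveLinearMap.norm_map_mul_sub_le {F : Type*} [CStarAlgebra F] [PartialOrder F]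
    [StarOrderedRing F] (Ψ : F →ₚ[ℂ] C) (h1 : ‖Ψ 1‖ ≤ 1) (x y d : F)
    (hd : Ψ (x * d) = Ψ x * Ψ d) :
    ‖Ψ (x * y) - Ψ x * Ψ y‖ ≤ 20 * ‖x‖ * ‖y - d‖ := by
  have hb : ∀ b, ‖Ψ b‖ ≤ 4 * ‖b‖ := fun b => (Ψ.norm_apply_le_four_mul b).trans (by
    have := mul_le_mul_of_nonneg_right h1 (norm_nonneg b)
    linarith)
  have hdec : Ψ (x * y) - Ψ x * Ψ y = Ψ (x * (y - d)) - Ψ x * Ψ (y - d) := by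
    rw [mul_sub, map_sub, map_sub, mul_sub, hd]; abel
  rw [hdec]
  calc ‖Ψ (x * (y - d)) - Ψ x * Ψ (y - d)‖
      ≤ 4 * (‖x‖ * ‖y - d‖) + (4 * ‖x‖) * (4 * ‖y - d‖) := by
        refine (norm_sub_le _ _).trans (add_le_add ?_ ?_)
        · refine (hb _).trans ?_
          gcongr
          exact norm_mul_le _ _
        · refine (norm_mul_le _ _).trans ?_
          gcongr
          · exact hb _
          · exact hb _
    _ = 20 * ‖x‖ * ‖y - d‖ := by ring

end Amplification

/-! ### Norm estimates for the amplified sequence. -/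

section ApproximatingSequences

variable {A : Type*} [CStarAlgebra A] [PartialOrder A] [StarOrderedRing A]
  {G : Type*} [Fintype G] [DecidableEq G]
  {C : ℕ → Type*} [∀ n, CStarAlgebra (C n)] [∀ n, PartialOrder (C n)]
  [∀ n, StarOrderedRing (C n)]

/-- The amplifications of an asymptotically isometric sequence of unital completely positive maps
with asymptotically dense multiplicative domains are asymptotically isometric. -/
theorem eventually_lt_norm_amplify (φ : ∀ n, A →CP C n) (h1 : ∀ n, φ n 1 = 1)
    (hnorm : ∀ a : A, Tendsto (fun n => ‖φ n a‖) atTop (𝓝 ‖a‖))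
    (hdense : ∀ a : A, ∃ d : ℕ → A, (∀ n, d n ∈ multiplicativeDomain (φ n)) ∧
      Tendsto d atTop (𝓝 a))
    (x : CStarMatrix G G A) {c : ℝ} (hc : c < ‖x‖) :
    ∀ᶠ n in atTop, c < ‖(φ n).amplify G x‖ := by
  have hone : ∀ n, ‖(φ n).amplify G 1‖ ≤ 1 := fun n => by
    rw [(φ n).amplify_one (h1 n)]
    rcases subsingleton_or_nontrivial (CStarMatrix G G (C n)) with _ | _
    · rw [Subsingleton.elim (1 : CStarMatrix G G (C n)) 0, norm_zero]
      exact zero_le_one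
    · exact CStarRing.norm_one.le
  refine eventually_lt_norm_of_asymptotically_multiplicative (fun n => (φ n).amplify G) hone
    (fun z hz => ?_) (fun x y => ?_) x hc
  · obtain ⟨s, t, hst⟩ : ∃ s t, z s t ≠ 0 := by
      by_contra! h
      exact hz (CStarMatrix.ext h)
    have hpos : 0 < ‖z s t‖ := norm_pos_iff.mpr hst
    refine ⟨‖z s t‖ / 2, half_pos hpos, ?_⟩
    filter_upwards [(hnorm (z s t)).eventually_const_lt (half_lt_self hpos)] with n hn
    exact hn.le.trans (CStarMatrix.norm_entry_le_norm (M := (φ n).amplify G z))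
  · choose d hd hlim using fun s t => hdense (y s t)
    let N : ℕ → CStarMatrix G G A := fun n => CStarMatrix.ofMatrix fun s t => d s t n
    have hN : Tendsto N atTop (𝓝 y) := CStarMatrix.tendsto_of_entries hlim
    have hN' : Tendsto (fun n => 20 * ‖x‖ * ‖y - N n‖) atTop (𝓝 0) := by
      simpa using (((tendsto_const_nhds (x := y)).sub hN).norm).const_mul (20 * ‖x‖)
    exact squeeze_zero (fun n => norm_nonneg _) (fun n =>
      ((φ n).amplify G).norm_map_mul_sub_le (hone n) x y (N n)
        ((φ n).amplify_mul (h1 n) x (N n) fun s t => hd s t n)) hN'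

end ApproximatingSequences

/-! ### Approximation inside the crossed product. -/

section CrossedProductApproximation

variable {A : Type*} [CStarAlgebra A] [PartialOrder A] [StarOrderedRing A]
  {G : Type*} [Group G] [Fintype G] [DecidableEq G]

/-- Elements of the crossed product are approximated by elements of the crossed product with
entries in invariant subalgebras `D n` that approximate all elements of `A`. -/
theorem CrossedProduct.eventually_exists_entriesIn (α : G →* (A ≃⋆ₐ[ℂ] A))
    (D : ℕ → StarSubalgebra ℂ A) (hα : ∀ n g, ∀ a ∈ D n, α g a ∈ D n)
    (hdense : ∀ a : A, ∃ d : ℕ → A, (∀ n, d n ∈ D n) ∧ Tendsto d atTop (𝓝 a))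
    {x : CStarMatrix G G A} (hx : x ∈ CrossedProduct α) {ε : ℝ} (hε : 0 < ε) :
    ∀ᶠ n in atTop, ∃ d ∈ CrossedProduct α, d ∈ CStarMatrix.entriesIn G (D n) ∧ ‖x - d‖ < ε := by
  have hgen : Set.range (covariantCoeff α) ∪ Set.range (covariantUnitary A (G := G)) ⊆
      CrossedProduct α := (StarAlgebra.subset_adjoin ℂ _).trans
    (StarSubalgebra.le_topologicalClosure _)
  have hadj : ∀ y ∈ StarAlgebra.adjoin ℂ
      (Set.range (covariantCoeff α) ∪ Set.range (covariantUnitary A (G := G))),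
      ∃ d : ℕ → CStarMatrix G G A, (∀ n, d n ∈ CrossedProduct α ⊓ CStarMatrix.entriesIn G (D n)) ∧
        Tendsto d atTop (𝓝 y) := by
    intro y hy
    induction hy using StarAlgebra.adjoin_induction with
    | mem y hy =>
      rcases hy with ⟨a, rfl⟩ | ⟨h, rfl⟩
      · obtain ⟨d, hd, hlim⟩ := hdense a
        refine ⟨fun n => covariantCoeff α (d n), fun n => ⟨hgen (.inl ⟨d n, rfl⟩), ?_⟩, ?_⟩
        · intro s t
          rcases eq_or_ne s t with rfl | hst
          -- Invariance of `D n` enters here: the diagonal entries are translates of `d n` by the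
          -- action.
          · simpa [covariantCoeff, ← map_inv] using hα n s⁻¹ _ (hd n)
          · simp [covariantCoeff, hst]
        · refine CStarMatrix.tendsto_of_entries fun s t => ?_
          rcases eq_or_ne s t with rfl | hst
          · have : Continuous ((α s)⁻¹ : A ≃⋆ₐ[ℂ] A) :=
              (NonUnitalStarAlgHom.isometry _ (EquivLike.injective _)).continuous
            simpa [covariantCoeff, Function.comp_def] using (this.tendsto a).comp hlim
          · simp [covariantCoeff, hst]
      · refine ⟨fun _ => covariantUnitary A h, fun n => ⟨hgen (.inr ⟨h, rfl⟩), fun s t => ?_⟩,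
          tendsto_const_nhds⟩
        by_cases hst : s = h * t <;> simp [covariantUnitary, hst]
    | algebraMap c => exact ⟨fun _ => algebraMap ℂ _ c, fun n => algebraMap_mem _ c,
        tendsto_const_nhds⟩
    | add y z _ _ hy hz =>
      obtain ⟨d, hd, hdl⟩ := hy
      obtain ⟨e, he, hel⟩ := hz
      exact ⟨fun n => d n + e n, fun n => add_mem (hd n) (he n), hdl.add hel⟩
    | mul y z _ _ hy hz =>
      obtain ⟨d, hd, hdl⟩ := hy
      obtain ⟨e, he, hel⟩ := hz
      exact ⟨fun n => d n * e n, fun n => mul_mem (hd n) (he n), hdl.mul hel⟩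
    | star y _ hy =>
      obtain ⟨d, hd, hdl⟩ := hy
      exact ⟨fun n => star (d n), fun n => star_mem (hd n), hdl.star⟩
  obtain ⟨y, hy, hxy⟩ := Metric.mem_closure_iff.mp
    (show x ∈ closure (StarAlgebra.adjoin ℂ
      (Set.range (covariantCoeff α) ∪ Set.range (covariantUnitary A (G := G))) :
      Set (CStarMatrix G G A)) from hx) (ε / 2) (half_pos hε)
  obtain ⟨d, hd, hlim⟩ := hadj y hy
  filter_upwards [Metric.tendsto_nhds.mp hlim (ε / 2) (half_pos hε)] with n hn
  refine ⟨d n, (hd n).1, (hd n).2, ?_⟩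
  rw [← dist_eq_norm]
  calc dist x (d n) ≤ dist x y + dist (d n) y := dist_triangle_right _ _ _
    _ < ε := by linarith

end CrossedProductApproximation

/-! ### Assembly of the main theorem. -/

theorem mainTheorem5 {A : Type*} [CStarAlgebra A] [PartialOrder A] [StarOrderedRing A]
    [TopologicalSpace.SeparableSpace A]
    {G : Type*} [Group G] [Fintype G] [DecidableEq G]
    (α : G →* (A ≃⋆ₐ[ℂ] A))
    (k : ℕ → ℕ) (φ : ∀ n, A →CP MatrixAlgebra (k n))
    (hφ_unital : ∀ n, φ n 1 = 1)
    (hφ_norm : ∀ a : A, Tendsto (fun n => ‖φ n a‖) atTop (𝓝 ‖a‖))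
    (hφ_dist : ∀ a : A,
      Tendsto (fun n => Metric.infDist a (multiplicativeDomain (φ n))) atTop (𝓝 0))
    (hα : ∀ (n : ℕ) (g : G), α g '' multiplicativeDomain (φ n) = multiplicativeDomain (φ n)) :
    InnerQuasidiagonal (CrossedProduct α) := by
  let D : ℕ → StarSubalgebra ℂ A := fun n => (φ n).domain (hφ_unital n)
  have hdense : ∀ a : A, ∃ d : ℕ → A, (∀ n, d n ∈ multiplicativeDomain (φ n)) ∧
      Tendsto d atTop (𝓝 a) := fun a =>
    exists_seq_tendsto_of_tendsto_infDist (fun n => ⟨1, (D n).one_mem⟩) (hφ_dist a)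
  have hαD : ∀ n g, ∀ a ∈ D n, α g a ∈ D n := fun n g a ha => by
    change α g a ∈ multiplicativeDomain (φ n)
    rw [← hα n g]
    exact ⟨a, ha, rfl⟩
  let _ := CStarAlgebra.spectralOrder (CrossedProduct α)
  have := CStarAlgebra.spectralOrderedRing (CrossedProduct α)
  refine innerQuasidiagonal_of_positive_maps fun m x ε hε => ?_
  have hev : ∀ᶠ n in atTop, ∀ i : Fin m,
      (∃ d ∈ CrossedProduct α, d ∈ CStarMatrix.entriesIn G (D n) ∧
        ‖(x i : CStarMatrix G G A) - d‖ < ε) ∧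
      ‖(x i : CStarMatrix G G A)‖ - ε < ‖(φ n).amplify G (x i)‖ :=
    eventually_all.mpr fun i =>
      (CrossedProduct.eventually_exists_entriesIn α D hαD hdense (x i).2 hε).and
        (eventually_lt_norm_amplify φ hφ_unital hφ_norm hdense _ (by linarith))
  obtain ⟨n, hn⟩ := hev.exists
  let Ψ : CrossedProduct α →ₚ[ℂ] (EuclideanSpace ℂ (G × Fin (k n)) →L[ℂ]
      EuclideanSpace ℂ (G × Fin (k n))) :=
    .mk₀ ((blockMatrixRep G (k n)).toAlgHom.toLinearMap ∘ₗ
      ((φ n).amplify G).toLinearMap ∘ₗ (CrossedProduct α).subtype.toAlgHom.toLinearMap)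
      fun b hb => by
        -- A square root inside the crossed product shows that its own positive elements are
        -- positive in `M_G(A)`.
        obtain ⟨y, rfl⟩ := CStarAlgebra.exists_eq_star_mul_self hb
        exact map_nonneg (blockMatrixRep G (k n)) (((φ n).amplify G).map_nonneg
          (star_mul_self_nonneg (y : CStarMatrix G G A)))
  have hΨ : ∀ b, Ψ b = blockMatrixRep G (k n) ((φ n).amplify G (b : CStarMatrix G G A)) :=
    fun b => rfl
  refine ⟨EuclideanSpace ℂ (G × Fin (k n)), inferInstance, inferInstance, inferInstance,
    inferInstance, Ψ, (CStarMatrix.entriesIn G (D n)).comap (CrossedProduct α).subtype,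
    ?_, fun d _ e he => ?_, fun i => ⟨?_, ?_⟩⟩
  · rw [hΨ, OneMemClass.coe_one, (φ n).amplify_one (hφ_unital n), map_one]
  · rw [hΨ, hΨ, hΨ, MulMemClass.coe_mul, (φ n).amplify_mul (hφ_unital n) d.1 e.1 he, map_mul]
  · obtain ⟨d, hdB, hdD, hd⟩ := (hn i).1
    exact ⟨⟨d, hdB⟩, hdD, hd⟩
  · rw [hΨ, norm_blockMatrixRep]
    exact (hn i).2
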